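/- Let $0<2k<n$ and let $\lambda=(\lambda_{ij})$ be a complex $n\times k$ matrix of rank $k$, with rows $\Lambda_i=(\lambda_{i1},\dots,\lambda_{ik})\in\mathbb{C}^k$. Let $\mathfrak F=(F^1,\dots,F^k)$ be the commuting linear vector fields $F^j(z)=\sum_{i=1}^n\lambda_{ij}z_i\,\partial/\partial z_i$ on $\mathbb{C}^n$, and consider the action of $\mathbb{C}^k$ on $\mathbb{C}^n$ that they generate, $(t\cdot z)_i=e^{\sum_j\lambda_{ij}t_j}z_i$, whose orbits are called leaves. Assume that $\mathfrak F$ is admissible: $0$ lies in the (real) convex hull of $\Lambda_1,\dots,\Lambda_n$, but for all $1\le i_1<\dots<i_{2k}\le n$ it does not lie in the convex hull of $\Lambda_{i_1},\dots,\Lambda_{i_{2k}}$. A leaf is a Siegel leaf if its closure does not contain $0$. Let $\mathcal S\subset\mathbb{C}^n$ be the union of the Siegel leaves; the space of Siegel leaves is the quotient of $\mathcal S$ by the relation of lying on the same leaf, with the quotient topology. Let $\Psi=(\psi^1,\dots,\psi^k):\mathbb{C}^n\to\mathbb{C}^k$, $$\psi^j(z)=\langle F^j(z),z\rangle=\sum_{i=1}^n\lambda_{ij}|z_i|^2,\qquad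 \mathcal T=\Psi^{-1}(0),\qquad \mathcal T^*=\mathcal T\setminus\{0\}.$$ Then: 1. $\Psi$ is a mixed map (real analytic in $z,\bar z$) and $\mathcal T$ is a mixed ICIS (isolated complete intersection singularity); that is, $\Psi(0)=0$, $n>k$, $\mathcal T$ has positive dimension at $0$, and $0$ is the only point of $\mathcal T$ at which the rank of the real Jacobian matrix of $\Psi$ is not maximal. 2. $\mathcal T^*$ is a smooth complex $(n-k)$-manifold that parametrizes the space of Siegel leaves. Precisely: $\mathcal S$ is open in $\mathbb C^n$ and contains $\mathcal T^*$; the map sending $z\in\mathcal T^*$ to the leaf through $z$ is a homeomorphism from $\mathcal T^*$ (with the topology induced from $\mathbb{C}^n$) onto the space of Siegel leaves; and $\mathcal T^*$ with this topology has the structure of a complex manifold of dimension $n-k$ for which the inclusion $\mathcal T^*\hookrightarrow\mathbb{C}^n$ is a $C^\infty$ immersion of real manifolds, and for which the map $\mathcal S\to\mathcal T^*$ that sends a point to the unique point of $\mathcal T^*$ on its leaf is a holomorphic submersion. -/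

import Mathlib

open scoped Manifold ContDiff Topology

/-! ### Mixed maps and mixed isolated complete intersection singularities -/

/-- `Cn n` is the Hermitian space `ℂⁿ`. -/
abbrev Cn (n : ℕ) : Type := EuclideanSpace ℂ (Fin n)

/-- A mixed map `ℂⁿ → ℂᵏ`: a map that is real analytic, i.e. analytic in `z` and `z̄`. -/
def IsMixedMap {n k : ℕ} (F : Cn n → Cn k) : Prop :=
  AnalyticOnNhd ℝ F Set.univ

/-- The set `Σ_F` of points where the rank of the real Jacobian of `F` is not maximal. -/
def mixedCriticalSet {n k : ℕ} (F : Cn n → Cn k) : Set (Cn n) :=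
  {a | Module.finrank ℝ (LinearMap.range (fderiv ℝ F a).toLinearMap) < min (2 * n) (2 * k)}

/-- The zero set `V_F`. -/
def mixedZeroSet {n k : ℕ} (F : Cn n → Cn k) : Set (Cn n) :=
  {z | F z = 0}

/-- `F : (ℂⁿ, 0) → (ℂᵏ, 0)` is a mixed ICIS. The dimension of the real analytic set `V_F` at the
origin is measured by the Hausdorff dimension, with which it coincides. -/
structure IsMixedICIS {n k : ℕ} (F : Cn n → Cn k) : Prop where
  isMixedMap : IsMixedMap F
  map_zero : F 0 = 0
  lt : k < n
  zeroSet_pos_dim : ∀ U ∈ 𝓝 (0 : Cn n), 0 < dimH (mixedZeroSet F ∩ U)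
  critical_inter_zeroSet : mixedCriticalSet F ∩ mixedZeroSet F = {0}

/-! ### Diagonal linear actions of `ℂᵏ` on `ℂⁿ` -/

section

variable {n k : ℕ} (lam : Matrix (Fin n) (Fin k) ℂ)

/-- The vector `Λ_i = (λ_{i1}, …, λ_{ik}) ∈ ℂᵏ`. -/
def eigenvec (i : Fin n) : Cn k := WithLp.toLp 2 (lam i)

/-- The linear vector field `F^j = ∑_i λ_{ij} z_i ∂/∂z_i`. -/
noncomputable def linField (j : Fin k) (z : Cn n) : Cn n :=
  WithLp.toLp 2 fun i => lam i j * z i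

/-- The action of `ℂᵏ` on `ℂⁿ` generated by the commuting fields `F^1, …, F^k`. -/
noncomputable def linAct (t : Cn k) (z : Cn n) : Cn n :=
  WithLp.toLp 2 fun i => Complex.exp (∑ j, lam i j * t j) * z i

theorem linAct_zero (z : Cn n) : linAct lam 0 z = z := by
  ext i
  simp [linAct]

theorem linAct_add (s t : Cn k) (z : Cn n) :
    linAct lam (s + t) z = linAct lam s (linAct lam t z) := by
  ext i
  simp [linAct, mul_add, Finset.sum_add_distrib, Complex.exp_add, mul_assoc]

/-- The `j`-th one-parameter subgroup of the action is the flow of `F^j`. -/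
theorem hasDerivAt_linAct (j : Fin k) (z : Cn n) (s : ℂ) :
    HasDerivAt (fun s : ℂ => linAct lam (EuclideanSpace.single j s) z)
      (linField lam j (linAct lam (EuclideanSpace.single j s) z)) s := by
  suffices h : HasDerivAt (fun (s : ℂ) (i : Fin n) => linAct lam (EuclideanSpace.single j s) z i)
      (fun i => linField lam j (linAct lam (EuclideanSpace.single j s) z) i) s from
    (EuclideanSpace.equiv (Fin n) ℂ).symm.toContinuousLinearMap.hasFDerivAt.comp_hasDerivAt s h
  refine hasDerivAt_pi.2 fun i => ?_
  have h1 : HasDerivAt (fun s : ℂ => lam i j * s) (lam i j) s := by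
    simpa using (hasDerivAt_id s).const_mul (lam i j)
  have h2 := (h1.cexp).mul_const (z i)
  have h3 : ∀ s : ℂ, ∑ l, lam i l * (EuclideanSpace.single j s : Cn k) l = lam i j * s := by
    intro s
    rw [Finset.sum_eq_single j]
    · simp
    · intro b _ hb
      simp [hb]
    · simp
  simp only [linAct, linField, h3]
  exact h2.congr_deriv (by ring)

/-- The action is in the Siegel domain: `0` lies in the convex hull of `Λ_1, …, Λ_n`. -/
def InSiegelDomain : Prop :=
  (0 : Cn k) ∈ convexHull ℝ (Set.range (eigenvec lam))

/-- Weak hyperbolicity: `0` is in the convex hull of no `2k` of the vectors `Λ_i`. -/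
def IsWeaklyHyperbolic : Prop :=
  ∀ i : Fin (2 * k) → Fin n, StrictMono i →
    (0 : Cn k) ∉ convexHull ℝ (Set.range fun m => eigenvec lam (i m))

/-- The frame `(F^1, …, F^k)` is admissible. -/
structure IsAdmissible : Prop where
  siegel : InSiegelDomain lam
  weaklyHyperbolic : IsWeaklyHyperbolic lam

/-- The leaf (orbit) through `z`. -/
def leaf (z : Cn n) : Set (Cn n) :=
  Set.range fun t : Cn k => linAct lam t z

/-- The union of the Siegel leaves, i.e. of the leaves whose closure does not contain `0`. -/
def siegelSet : Set (Cn n) :=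
  {z | (0 : Cn n) ∉ closure (leaf lam z)}

/-- The space of Siegel leaves: the quotient of the union of the Siegel leaves by the relation of
lying on the same leaf. It carries the quotient topology. -/
abbrev SiegelLeafSpace : Type :=
  Quotient (Setoid.ker fun z : siegelSet lam => leaf lam (z : Cn n))

/-- The map `Ψ = (ψ^1, …, ψ^k)`, `ψ^j(z) = ∑_i λ_{ij} |z_i|²`. -/
noncomputable def siegelMap (z : Cn n) : Cn k :=
  WithLp.toLp 2 fun j => ∑ i, lam i j * ((‖z i‖ ^ 2 : ℝ) : ℂ)

/-- `ψ^j(z)` is the Hermitian product `⟨F^j(z), z⟩`; Mathlib's product is linear in its second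
argument. -/
theorem siegelMap_apply (z : Cn n) (j : Fin k) :
    siegelMap lam z j = inner ℂ z (linField lam j z) := by
  simp only [siegelMap, linField, PiLp.inner_apply, RCLike.inner_apply]
  refine Finset.sum_congr rfl fun i _ => ?_
  rw [mul_assoc, Complex.mul_conj, Complex.normSq_eq_norm_sq]

/-- `𝒯* = Ψ⁻¹(0) ∖ {0}`, used as a type with the topology induced from `ℂⁿ`. -/
def siegelStar : Set (Cn n) :=
  mixedZeroSet (siegelMap lam) \ {0}

end

/-! Let `weight i` be the linear form `t ↦ ∑_j λ_{ij} t_j`. On a leaf, `‖t · z‖² = ∑ |z_i|² exp (2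
Re (weight i t))` is a convex function of `t`, and its gradient at `t` is, up to conjugation and a
constant, `Ψ (t · z)`. So the zeros of `Ψ` are the points of minimal norm on their leaves, as in
Kempf–Ness theory.

Weak hyperbolicity enters through Carathéodory's theorem: the `Λ_i` occurring in a vanishing
nonnegative combination span `ℂᵏ` over the reals
(`IsWeaklyHyperbolic.eq_zero_of_weight_re_eq_zero`). On a Siegel leaf the support of `z` carries
such a combination, by Hahn–Banach. Hence the norm is proper along the leaf and a minimum exists;
strict convexity makes it unique and the action free.

The derivative of `Ψ` along an orbit is a Hessian, nondegenerate at points of `𝒯*`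
(`IsWeaklyHyperbolic.injective_fderiv_siegelMap_linAct`). This gives rank `2k` off the origin, hence
the ICIS property. By the implicit function theorem the time `siegelTime` needed to reach `𝒯*` is
real analytic, so `𝒮` is open and the projection `siegelRetr` is continuous.

The complex structure comes from the leaf space. In holomorphic charts `(t, x) ↦ t · (w + B x)` the
coordinate `x` is constant along the leaf direction, so near a point `x ∘ siegelRetr` equals `x`
composed with one fixed translation of the action. It is therefore holomorphic although `siegelRetr`
need not be, and the restrictions of `x` to `𝒯*` form a complex atlas. -/

section

/-! ### Weights, weak hyperbolicity and minimal points of leaves -/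

variable {n k : ℕ} (lam : Matrix (Fin n) (Fin k) ℂ)

/-- The linear form `t ↦ ∑_j λ_{ij} t_j`. -/
noncomputable def weight (i : Fin n) : Cn k →L[ℂ] ℂ :=
  ∑ j, lam i j • (EuclideanSpace.proj j : Cn k →L[ℂ] ℂ)

theorem weight_apply (i : Fin n) (t : Cn k) : weight lam i t = ∑ j, lam i j * t j := by
  simp [weight]

theorem linAct_apply (t : Cn k) (z : Cn n) (i : Fin n) :
    linAct lam t z i = Complex.exp (weight lam i t) * z i := by
  simp [linAct, weight_apply]

theorem siegelMap_apply_eq_sum (z : Cn n) (j : Fin k) :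
    siegelMap lam z j = ∑ i, lam i j * ((‖z i‖ ^ 2 : ℝ) : ℂ) := rfl

theorem linAct_apply_eq_zero {t : Cn k} {z : Cn n} {i : Fin n} :
    linAct lam t z i = 0 ↔ z i = 0 := by
  simp [linAct_apply, Complex.exp_ne_zero]

theorem linAct_eq_zero {t : Cn k} {z : Cn n} : linAct lam t z = 0 ↔ z = 0 := by
  constructor
  · intro h
    ext i
    have := congrArg (fun v : Cn n => v i) h
    simpa [linAct_apply_eq_zero] using this
  · rintro rfl
    ext i
    simp [linAct_apply]

theorem linAct_neg_linAct (t : Cn k) (z : Cn n) : linAct lam (-t) (linAct lam t z) = z := by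
  rw [← linAct_add, neg_add_cancel, linAct_zero]

theorem leaf_linAct (t : Cn k) (z : Cn n) : leaf lam (linAct lam t z) = leaf lam z := by
  ext y
  constructor
  · rintro ⟨s, rfl⟩
    exact ⟨s + t, linAct_add lam s t z⟩
  · rintro ⟨s, rfl⟩
    exact ⟨s - t, by simp only; rw [← linAct_add, sub_add_cancel]⟩

theorem mem_leaf_self (z : Cn n) : z ∈ leaf lam z := ⟨0, linAct_zero lam z⟩

theorem linAct_mem_siegelSet {t : Cn k} {z : Cn n} :
    linAct lam t z ∈ siegelSet lam ↔ z ∈ siegelSet lam := by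
  simp [siegelSet, leaf_linAct]

theorem mem_siegelStar {z : Cn n} : z ∈ siegelStar lam ↔ siegelMap lam z = 0 ∧ z ≠ 0 := Iff.rfl

/-- A vanishing combination of the `Λ_i` annihilates the forms `weight i`. -/
theorem sum_weight_eq_zero {c : Fin n → ℝ} (hc : ∀ j, ∑ i, lam i j * (c i : ℂ) = 0) (t : Cn k) :
    ∑ i, c i * (weight lam i t).re = 0 := by
  have h : ∑ i, (c i : ℂ) * weight lam i t = 0 := by
    simp only [weight_apply, Finset.mul_sum]
    rw [Finset.sum_comm]
    refine Finset.sum_eq_zero fun j _ => ?_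
    rw [← zero_mul (t j), ← hc j, Finset.sum_mul]
    exact Finset.sum_congr rfl fun i _ => by ring
  simpa using congrArg Complex.re h

theorem sum_smul_eigenvec_eq_zero {c : Fin n → ℝ}
    (hc : ∀ j, ∑ i, lam i j * (c i : ℂ) = 0) : ∑ i, c i • eigenvec lam i = 0 := by
  ext j
  simpa [eigenvec, mul_comm] using hc j

variable {lam}

/-- If `Λ_1, …, Λ_n` are weakly hyperbolic, the `Λ_i` with a nonzero coefficient in a vanishing
nonnegative combination span `ℂᵏ` over the reals. -/
theorem IsWeaklyHyperbolic.eq_zero_of_weight_re_eq_zero (hkn : 2 * k ≤ n)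
    (h : IsWeaklyHyperbolic lam) {c : Fin n → ℝ} (hc0 : ∀ i, 0 ≤ c i) (hcne : c ≠ 0)
    (hc : ∀ j, ∑ i, lam i j * (c i : ℂ) = 0) {t : Cn k}
    (ht : ∀ i, c i ≠ 0 → (weight lam i t).re = 0) : t = 0 := by
  classical
  by_contra htne
  obtain ⟨i₀, hi₀⟩ := Function.ne_iff.1 hcne
  have hpos : 0 < ∑ i, c i :=
    Finset.sum_pos' (fun i _ => hc0 i) ⟨i₀, Finset.mem_univ _, lt_of_le_of_ne (hc0 i₀) (Ne.symm hi₀)⟩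
  have hmem : (0 : Cn k) ∈ convexHull ℝ (eigenvec lam '' {i | c i ≠ 0}) := by
    have h1 := Finset.centerMass_mem_convexHull (R := ℝ) (s := eigenvec lam '' {i | c i ≠ 0})
      (Finset.univ.filter fun i => c i ≠ 0)
      (w := c) (z := eigenvec lam) (fun i _ => hc0 i) (by rwa [Finset.sum_filter_ne_zero])
      (fun i hi => ⟨i, by simpa using hi, rfl⟩)
    rw [Finset.centerMass_filter_ne_zero, Finset.centerMass,
      sum_smul_eigenvec_eq_zero lam hc, smul_zero] at h1
    exact h1
  obtain ⟨ι, _, v, w, hv, hai, hw0, hw1, hwv⟩ := eq_pos_convex_span_of_mem_convexHull hmem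
  -- `φ (Λ_i) = Re (weight i t)`, so all `Λ_i` with `c i ≠ 0` lie in the real hyperplane `ker φ` of
  -- dimension `2k - 1`. There Carathéodory needs at most `2k` of them.
  let φ : Cn k →ₗ[ℝ] ℝ :=
    { toFun := fun x => (∑ j, x j * t j).re
      map_add' := fun x y => by simp [add_mul, Finset.sum_add_distrib]
      map_smul' := fun a x => by simp [Finset.mul_sum, mul_assoc, mul_sub] }
  have hφ : φ ≠ 0 := by
    intro h0
    have h1 : φ (WithLp.toLp 2 fun j => star (t j)) = 0 := by rw [h0]; rfl
    have h2 : ∀ j, star (t j) * t j = ((‖t j‖ ^ 2 : ℝ) : ℂ) := fun j => by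
      rw [mul_comm]
      simp [Complex.mul_conj, Complex.normSq_eq_norm_sq]
    simp only [φ, LinearMap.coe_mk, AddHom.coe_mk, h2] at h1
    rw [← Complex.ofReal_sum, Complex.ofReal_re,
      Finset.sum_eq_zero_iff_of_nonneg (fun _ _ => by positivity)] at h1
    exact htne (by ext j; simpa using h1 j (Finset.mem_univ _))
  have hvφ : ∀ a, φ (v a) = 0 := by
    intro a
    obtain ⟨i, hi, hia⟩ := hv ⟨a, rfl⟩
    rw [← hia]
    simpa [φ, eigenvec, weight_apply] using ht i hi
  have hle : vectorSpan ℝ (Set.range v) ≤ LinearMap.ker φ := by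
    rw [vectorSpan_def, Submodule.span_le]
    rintro _ ⟨_, ⟨a, rfl⟩, _, ⟨b, rfl⟩, rfl⟩
    simp [hvφ]
  have hcard : Fintype.card ι ≤ 2 * k := by
    have h1 := hai.card_le_finrank_succ
    have h2 := Submodule.finrank_mono hle
    have h3 := Module.Dual.finrank_ker_add_one_of_ne_zero (f := φ) hφ
    have h4 : Module.finrank ℝ (Cn k) = 2 * k := by
      rw [finrank_real_of_complex]; simp
    omega
  choose idx hidx using fun a => hv (Set.mem_range_self a)
  -- Hyperbolicity speaks of exactly `2k` indices, so the index set is padded.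
  obtain ⟨J, hJ, hJc⟩ := Finset.exists_superset_card_eq
    (s := Finset.univ.image idx) (n := 2 * k)
    (Finset.card_image_le.trans (by simpa using hcard)) (by simpa using hkn)
  refine h (J.orderEmbOfFin hJc) (J.orderEmbOfFin hJc).strictMono ?_
  rw [← hwv]
  refine (convex_convexHull ℝ _).sum_mem (fun a _ => (hw0 a).le) hw1 fun a _ => ?_
  refine subset_convexHull ℝ _ ?_
  have ha : idx a ∈ Set.range (J.orderEmbOfFin hJc) := by
    rw [Finset.range_orderEmbOfFin]
    exact hJ (Finset.mem_image_of_mem _ (Finset.mem_univ _))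
  obtain ⟨m, hm⟩ := ha
  exact ⟨m, by simp only [hm]; exact (hidx a).2⟩

theorem exists_weights_of_zero_mem_convexHull {I : Set (Fin n)}
    (h : (0 : Cn k) ∈ convexHull ℝ (eigenvec lam '' I)) :
    ∃ c : Fin n → ℝ, (∀ i, 0 ≤ c i) ∧ c ≠ 0 ∧ (∀ i, i ∉ I → c i = 0) ∧
      ∀ j, ∑ i, lam i j * (c i : ℂ) = 0 := by
  classical
  obtain ⟨ι, _, w, v, hw0, hw1, hv, hwv⟩ := mem_convexHull_iff_exists_fintype.1 h
  choose idx hidx using hv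
  -- Several points of the combination may have the same index; their weights are added.
  refine ⟨fun i => ∑ a with idx a = i, w a, fun i => Finset.sum_nonneg fun a _ => hw0 a, ?_, ?_, ?_⟩
  · intro h0
    have h1 : ∑ i, ∑ a with idx a = i, w a = 1 := by
      rw [Finset.sum_fiberwise, hw1]
    rw [Finset.sum_eq_zero fun i _ => congrFun h0 i] at h1
    exact zero_ne_one h1
  · intro i hi
    refine Finset.sum_eq_zero fun a ha => ?_
    exact absurd ((Finset.mem_filter.1 ha).2 ▸ (hidx a).1) hi
  · intro j
    have h1 : ∑ a, lam (idx a) j * (w a : ℂ) = 0 := by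
      have := congrArg (fun x : Cn k => x j) hwv
      simpa [← (hidx _).2, eigenvec, mul_comm] using this
    rw [← h1, ← Finset.sum_fiberwise Finset.univ idx]
    refine Finset.sum_congr rfl fun i _ => ?_
    rw [Complex.ofReal_sum, Finset.mul_sum]
    refine Finset.sum_congr rfl fun a ha => ?_
    rw [(Finset.mem_filter.1 ha).2]

theorem norm_sq_linAct (t : Cn k) (z : Cn n) :
    ‖linAct lam t z‖ ^ 2 = ∑ i, ‖z i‖ ^ 2 * Real.exp (2 * (weight lam i t).re) := by
  rw [EuclideanSpace.norm_sq_eq]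
  refine Finset.sum_congr rfl fun i _ => ?_
  rw [linAct_apply, norm_mul, Complex.norm_exp, mul_pow, ← Real.exp_nat_mul]
  push_cast
  ring

theorem sum_weight_of_siegelMap_eq_zero {z : Cn n} (hz : siegelMap lam z = 0) (t : Cn k) :
    ∑ i, ‖z i‖ ^ 2 * (weight lam i t).re = 0 :=
  sum_weight_eq_zero lam (c := fun i => ‖z i‖ ^ 2)
    (fun j => by rw [← siegelMap_apply_eq_sum, hz]; rfl) t

/-- A zero of `Ψ` is a point of minimal norm of its leaf. -/
theorem norm_le_norm_linAct {z : Cn n} (hz : siegelMap lam z = 0) (t : Cn k) :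
    ‖z‖ ≤ ‖linAct lam t z‖ := by
  refine le_of_sq_le_sq ?_ (norm_nonneg _)
  rw [norm_sq_linAct, EuclideanSpace.norm_sq_eq]
  have h := sum_weight_of_siegelMap_eq_zero hz t
  -- The linear part of `1 + x ≤ exp x` cancels because `Ψ z = 0`.
  calc ∑ i, ‖z i‖ ^ 2 = ∑ i, ‖z i‖ ^ 2 * (2 * (weight lam i t).re + 1) := by
        simp only [mul_add, mul_one, Finset.sum_add_distrib, mul_left_comm _ (2 : ℝ),
          ← Finset.mul_sum, h]
        simp
    _ ≤ _ := Finset.sum_le_sum fun i _ =>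
        mul_le_mul_of_nonneg_left (Real.add_one_le_exp _) (by positivity)

theorem siegelStar_subset_siegelSet : siegelStar lam ⊆ siegelSet lam := by
  intro z hz h0
  obtain ⟨y, ⟨t, rfl⟩, hy⟩ := Metric.mem_closure_iff.1 h0 ‖z‖ (norm_pos_iff.2 hz.2)
  rw [dist_zero_left] at hy
  exact (norm_le_norm_linAct hz.1 t).not_gt hy

variable (hkn : 2 * k ≤ n) (h : IsWeaklyHyperbolic lam)
include hkn h

theorem IsWeaklyHyperbolic.eq_zero_of_mem_siegelStar {z : Cn n} (hz : z ∈ siegelStar lam)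
    {t : Cn k} (ht : ∀ i, z i ≠ 0 → (weight lam i t).re = 0) : t = 0 := by
  refine h.eq_zero_of_weight_re_eq_zero hkn (c := fun i => ‖z i‖ ^ 2) (fun i => by positivity)
    ?_ (fun j => by rw [← siegelMap_apply_eq_sum, hz.1]; rfl) (fun i hi => ht i fun h0 => hi ?_)
  · intro h0
    refine hz.2 ?_
    ext i
    simpa using congrFun h0 i
  · simp [h0]

/-- A leaf meets `𝒯*` at most once, and the action is free there. -/
theorem IsWeaklyHyperbolic.eq_zero_of_linAct_mem_siegelStar {z : Cn n} (hz : z ∈ siegelStar lam)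
    {t : Cn k} (ht : linAct lam t z ∈ siegelStar lam) : t = 0 := by
  -- The point `t · z` is minimal too, so `1 + x ≤ exp x` must be an equality in every term of the
  -- support, which forces `x = 0`.
  have hn : ‖linAct lam t z‖ ≤ ‖z‖ := by
    simpa [linAct_neg_linAct] using norm_le_norm_linAct ht.1 (-t)
  have hn2 : ‖linAct lam t z‖ ^ 2 ≤ ‖z‖ ^ 2 := by gcongr
  have hs := sum_weight_of_siegelMap_eq_zero hz.1 t
  have hnn : ∀ i, 0 ≤ ‖z i‖ ^ 2 *
      (Real.exp (2 * (weight lam i t).re) - (2 * (weight lam i t).re + 1)) := fun i =>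
    mul_nonneg (by positivity) (sub_nonneg.2 (Real.add_one_le_exp _))
  have hz0 : ∑ i, ‖z i‖ ^ 2 *
      (Real.exp (2 * (weight lam i t).re) - (2 * (weight lam i t).re + 1)) ≤ 0 := by
    rw [norm_sq_linAct, EuclideanSpace.norm_sq_eq] at hn2
    simp only [mul_sub, mul_add, mul_one, Finset.sum_add_distrib, Finset.sum_sub_distrib,
      mul_left_comm _ (2 : ℝ), ← Finset.mul_sum, hs]
    linarith
  have hz1 := (Finset.sum_eq_zero_iff_of_nonneg fun i _ => hnn i).1
    (le_antisymm hz0 (Finset.sum_nonneg fun i _ => hnn i))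
  refine h.eq_zero_of_mem_siegelStar hkn hz fun i hi => ?_
  by_contra hne
  have h2 : 2 * (weight lam i t).re ≠ 0 := by simpa using hne
  have h3 := Real.add_one_lt_exp h2
  have h4 := hz1 i (Finset.mem_univ _)
  have h5 : 0 < ‖z i‖ := norm_pos_iff.2 hi
  rcases mul_eq_zero.1 h4 with h6 | h6
  · exact absurd h6 (by positivity)
  · linarith

end

/-! ### Existence of minimal points on Siegel leaves -/

section

variable {n k : ℕ} {lam : Matrix (Fin n) (Fin k) ℂ}

/-- The support of a point of a Siegel leaf carries a vanishing convex combination of the `Λ_i`. -/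
theorem zero_mem_convexHull_of_mem_siegelSet {z : Cn n} (hz : z ∈ siegelSet lam) :
    (0 : Cn k) ∈ convexHull ℝ (eigenvec lam '' {i | z i ≠ 0}) := by
  by_contra hnot
  refine hz ?_
  obtain ⟨f, u, hu0, hu⟩ := RCLike.geometric_hahn_banach_point_closed (𝕜 := ℂ)
    (convex_convexHull ℝ (eigenvec lam '' {i | z i ≠ 0}))
    ((Set.toFinite _).isClosed_convexHull ℝ) hnot
  simp only [map_zero] at hu0
  -- With this `t`, `weight i t = -f (Λ_i)` has negative real part on the support of `z`, so the ray
  -- `s t`, `s → ∞`, carries `z` to `0`.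
  set t : Cn k := WithLp.toLp 2 fun j => -f (EuclideanSpace.single j 1) with ht
  have hf : ∀ x : Cn k, f x = ∑ j, x j * f (EuclideanSpace.single j 1) := by
    intro x
    have hx : x = ∑ j, x j • (EuclideanSpace.single j (1 : ℂ) : Cn k) := by
      ext l
      simp [Pi.single_apply]
    conv_lhs => rw [hx]
    simp
  have hneg : ∀ i, z i ≠ 0 → (weight lam i t).re < 0 := by
    intro i hi
    have h1 := hu _ (subset_convexHull ℝ _ ⟨i, hi, rfl⟩)
    have h2 : weight lam i t = -f (eigenvec lam i) := by
      rw [hf, weight_apply]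
      simp [ht, eigenvec]
    rw [h2, Complex.neg_re]
    have h3 : (0 : ℝ) < u := hu0
    have h4 : u < (f (eigenvec lam i)).re := h1
    linarith
  have hlim : Filter.Tendsto (fun s : ℝ => ‖linAct lam ((s : ℂ) • t) z‖ ^ 2) Filter.atTop (𝓝 0) := by
    simp only [norm_sq_linAct]
    have h0 : (0 : ℝ) = ∑ _i : Fin n, (0 : ℝ) := by simp
    rw [h0]
    refine tendsto_finsetSum _ fun i _ => ?_
    by_cases hi : z i = 0
    · simp [hi]
    · rw [← mul_zero (‖z i‖ ^ 2)]
      refine Filter.Tendsto.const_mul _ (Real.tendsto_exp_atBot.comp ?_)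
      have h1 : ∀ s : ℝ, 2 * (weight lam i ((s : ℂ) • t)).re = (2 * (weight lam i t).re) * s := by
        intro s
        simp
        ring
      simp only [h1]
      exact Filter.tendsto_id.const_mul_atTop_of_neg (by linarith [hneg i hi])
  have hlim2 : Filter.Tendsto (fun s : ℝ => linAct lam ((s : ℂ) • t) z) Filter.atTop (𝓝 0) := by
    rw [tendsto_zero_iff_norm_tendsto_zero]
    simpa [Real.sqrt_sq] using hlim.sqrt
  exact mem_closure_of_tendsto hlim2 (Filter.Eventually.of_forall fun s => ⟨_, rfl⟩)

/-- The directional derivatives of `‖t · z‖²` at `0` vanish; the directions `e_j` and `i e_j` give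
the real and imaginary parts of `ψ^j`. -/
theorem siegelMap_eq_zero_of_isMinOn {z : Cn n}
    (hmin : ∀ t, ‖z‖ ^ 2 ≤ ‖linAct lam t z‖ ^ 2) : siegelMap lam z = 0 := by
  have hre : ∀ u : Cn k, ∑ i, ‖z i‖ ^ 2 * (weight lam i u).re = 0 := by
    intro u
    have h1 : IsLocalMin
        (fun s : ℝ => ∑ i, ‖z i‖ ^ 2 * Real.exp (s * (2 * (weight lam i u).re))) 0 := by
      refine Filter.Eventually.of_forall fun s => ?_
      have h2 := hmin ((s : ℂ) • u)
      rw [norm_sq_linAct, EuclideanSpace.norm_sq_eq] at h2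
      simpa [mul_left_comm] using h2
    have h3 : HasDerivAt
        (fun s : ℝ => ∑ i, ‖z i‖ ^ 2 * Real.exp (s * (2 * (weight lam i u).re)))
        (∑ i, ‖z i‖ ^ 2 * (Real.exp (0 * (2 * (weight lam i u).re)) *
          (1 * (2 * (weight lam i u).re)))) 0 :=
      HasDerivAt.fun_sum fun i _ =>
        (((hasDerivAt_id (0 : ℝ)).mul_const _).exp).const_mul _
    have h4 := h1.hasDerivAt_eq_zero h3
    simp only [zero_mul, one_mul, mul_left_comm _ (2 : ℝ), ← Finset.mul_sum] at h4
    simpa using h4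
  ext j
  rw [siegelMap_apply_eq_sum]
  have hw : ∀ (i : Fin n) (a : ℂ), weight lam i (EuclideanSpace.single j a) = lam i j * a := by
    intro i a
    rw [weight_apply, Finset.sum_eq_single j] <;> simp +contextual
  have h1 := hre (EuclideanSpace.single j 1)
  have h2 := hre (EuclideanSpace.single j Complex.I)
  simp only [hw] at h1 h2
  apply Complex.ext
  · simpa [mul_comm, ← Complex.ofReal_pow] using h1
  · simpa [mul_comm, ← Complex.ofReal_pow] using h2

theorem continuous_linAct :
    Continuous fun p : Cn k × Cn n => linAct lam p.1 p.2 := by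
  unfold linAct
  fun_prop

/-- Every Siegel leaf meets `𝒯*`. -/
theorem IsWeaklyHyperbolic.exists_linAct_mem_siegelStar (hkn : 2 * k ≤ n)
    (h : IsWeaklyHyperbolic lam) {z : Cn n} (hz : z ∈ siegelSet lam) :
    ∃ t, linAct lam t z ∈ siegelStar lam := by
  have hz0 : z ≠ 0 := by
    rintro rfl
    exact hz (subset_closure (mem_leaf_self lam 0))
  obtain ⟨c, hc0, hcne, hcz, hc⟩ :=
    exists_weights_of_zero_mem_convexHull (zero_mem_convexHull_of_mem_siegelSet hz)
  obtain ⟨M, hM0, hM⟩ : ∃ M : ℝ, 0 ≤ M ∧ ∀ i, c i ≤ M * ‖z i‖ ^ 2 := by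
    have hnn : ∀ i, 0 ≤ c i / ‖z i‖ ^ 2 := fun i => div_nonneg (hc0 i) (by positivity)
    refine ⟨∑ i, c i / ‖z i‖ ^ 2, Finset.sum_nonneg fun i _ => hnn i, fun i => ?_⟩
    by_cases hi : z i = 0
    · rw [hcz i (by simpa using hi)]
      simp [hi]
    · have h1 := Finset.single_le_sum (fun i _ => hnn i) (Finset.mem_univ i)
      rwa [div_le_iff₀ (by have := norm_pos_iff.2 hi; positivity)] at h1
  let L : Cn k →ₗ[ℝ] (Fin n → ℝ) :=
    { toFun := fun t i => c i * (weight lam i t).re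
      map_add' := fun x y => by ext i; simp [mul_add]
      map_smul' := fun a x => by
        ext i
        change c i * (weight lam i (a • x)).re = a * (c i * (weight lam i x).re)
        rw [← Complex.coe_smul, map_smul, smul_eq_mul, Complex.re_ofReal_mul, mul_left_comm] }
  have hL : LinearMap.ker L = ⊥ := by
    refine LinearMap.ker_eq_bot'.2 fun t ht => ?_
    refine h.eq_zero_of_weight_re_eq_zero hkn hc0 hcne hc fun i hi => ?_
    exact (mul_eq_zero.1 (congrFun ht i)).resolve_left hi
  obtain ⟨K, hK, hanti⟩ := L.exists_antilipschitzWith hL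
  -- Properness: for `x_i = Re (weight i t)`, adding `∑ c_i x_i = 0` and using `|x| + x ≤ exp (2x)`
  -- bounds `∑ c_i |x_i|` by `M ‖t · z‖²`.
  have hbound : ∀ t, ‖t‖ ≤ K * M * ‖linAct lam t z‖ ^ 2 := by
    intro t
    have h1 : ‖t‖ ≤ K * ‖L t‖ := by simpa using hanti.le_mul_dist t 0
    have h2 : ‖L t‖ ≤ ∑ i, c i * |(weight lam i t).re| := by
      refine (pi_norm_le_iff_of_nonneg
        (Finset.sum_nonneg fun i _ => mul_nonneg (hc0 i) (abs_nonneg _))).2 fun i => ?_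
      have h3 : ‖L t i‖ = c i * |(weight lam i t).re| := by
        simp [L, abs_of_nonneg (hc0 i)]
      rw [h3]
      exact Finset.single_le_sum (f := fun i => c i * |(weight lam i t).re|)
        (fun i _ => mul_nonneg (hc0 i) (abs_nonneg _)) (Finset.mem_univ i)
    have h4 : ∑ i, c i * |(weight lam i t).re| ≤ M * ‖linAct lam t z‖ ^ 2 := by
      rw [norm_sq_linAct, Finset.mul_sum, ← add_zero (∑ i, c i * |(weight lam i t).re|),
        ← sum_weight_eq_zero lam hc t, ← Finset.sum_add_distrib]
      refine Finset.sum_le_sum fun i _ => ?_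
      have h5 : |(weight lam i t).re| + (weight lam i t).re ≤
          Real.exp (2 * (weight lam i t).re) := by
        rcases abs_cases (weight lam i t).re with ⟨h6, _⟩ | ⟨h6, _⟩ <;> rw [h6]
        · linarith [Real.add_one_le_exp (2 * (weight lam i t).re)]
        · linarith [Real.exp_pos (2 * (weight lam i t).re)]
      rw [← mul_add, ← mul_assoc]
      exact mul_le_mul (hM i) h5 (by linarith [neg_abs_le (weight lam i t).re])
        (mul_nonneg hM0 (by positivity))
    calc ‖t‖ ≤ K * ‖L t‖ := h1
      _ ≤ K * (M * ‖linAct lam t z‖ ^ 2) :=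
        mul_le_mul_of_nonneg_left (h2.trans h4) K.coe_nonneg
      _ = _ := by ring
  have hKM : 0 < (K * M + 1 : ℝ) := by positivity
  have hlim : Filter.Tendsto (fun t : Cn k => ‖linAct lam t z‖ ^ 2) (Filter.cocompact _)
      Filter.atTop := by
    refine Filter.tendsto_atTop_mono (f := fun t : Cn k => ‖t‖ / (K * M + 1)) (fun t => ?_)
      ((tendsto_norm_cocompact_atTop).atTop_div_const hKM)
    rw [div_le_iff₀ hKM]
    nlinarith [hbound t, sq_nonneg ‖linAct lam t z‖]
  have hcont : Continuous fun t : Cn k => ‖linAct lam t z‖ ^ 2 := by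
    have := (continuous_linAct (lam := lam)).comp (Continuous.prodMk_left z)
    exact this.norm.pow 2
  obtain ⟨t₀, ht₀⟩ := hcont.exists_forall_le hlim
  refine ⟨t₀, siegelMap_eq_zero_of_isMinOn fun t => ?_, by simpa [linAct_eq_zero] using hz0⟩
  rw [← linAct_add]
  exact ht₀ (t + t₀)

end

/-! ### Regularity of `Ψ` and the mixed ICIS property -/

section

variable {n k : ℕ} {lam : Matrix (Fin n) (Fin k) ℂ}

theorem contDiff_siegelMap {m : ℕ∞ω} : ContDiff ℝ m (siegelMap lam) := by
  have h : siegelMap lam = fun z => ∑ i, (‖z i‖ ^ 2) • eigenvec lam i := by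
    ext z j
    simp [siegelMap, eigenvec, mul_comm]
  rw [h]
  refine ContDiff.sum fun i _ => ContDiff.smul (ContDiff.norm_sq ℝ ?_) contDiff_const
  exact ((EuclideanSpace.proj i : Cn n →L[ℂ] ℂ).restrictScalars ℝ).contDiff

theorem contDiffAt_linAct {E : Type*} [NormedAddCommGroup E] [NormedSpace ℂ E] {m : ℕ∞ω} {x : E}
    {f : E → Cn k} {g : E → Cn n} (hf : ContDiffAt ℂ m f x) (hg : ContDiffAt ℂ m g x) :
    ContDiffAt ℂ m (fun y => linAct lam (f y) (g y)) x := by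
  refine contDiffAt_piLp' 2 fun i => ?_
  simp only [linAct_apply]
  exact (((weight lam i).contDiff.contDiffAt.comp x hf).cexp).mul
    ((EuclideanSpace.proj i : Cn n →L[ℂ] ℂ).contDiff.contDiffAt.comp x hg)

theorem contDiffAt_linAct_real {E : Type*} [NormedAddCommGroup E] [NormedSpace ℝ E] {m : ℕ∞ω}
    {x : E} {f : E → Cn k} {g : E → Cn n} (hf : ContDiffAt ℝ m f x) (hg : ContDiffAt ℝ m g x) :
    ContDiffAt ℝ m (fun y => linAct lam (f y) (g y)) x := by
  refine contDiffAt_piLp' 2 fun i => ?_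
  simp only [linAct_apply]
  exact ((((weight lam i).restrictScalars ℝ).contDiff.contDiffAt.comp x hf).cexp).mul
    (((EuclideanSpace.proj i : Cn n →L[ℂ] ℂ).restrictScalars ℝ).contDiff.contDiffAt.comp x hg)

theorem isMixedMap_siegelMap : IsMixedMap (siegelMap lam) :=
  contDiff_omega_iff_analyticOnNhd.1 contDiff_siegelMap

theorem contDiff_siegelMap_linAct {m : ℕ∞ω} :
    ContDiff ℝ m fun p : Cn n × Cn k => siegelMap lam (linAct lam p.2 p.1) :=
  ContDiff.comp (g := siegelMap lam) contDiff_siegelMap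
    (contDiff_iff_contDiffAt.2 fun _ => contDiffAt_linAct_real contDiffAt_snd contDiffAt_fst)

/-- Pairing `Ψ` with the direction `s` gives half the derivative of the squared norm along `s`. Its
derivative is `2 ∑ |w_i|² (Re (weight i s))²` with `w = t · z`, which vanishes only for `s = 0`. -/
theorem IsWeaklyHyperbolic.injective_fderiv_siegelMap_linAct (hkn : 2 * k ≤ n)
    (h : IsWeaklyHyperbolic lam) {z : Cn n} {t : Cn k} (ht : linAct lam t z ∈ siegelStar lam) :
    Function.Injective (fderiv ℝ (fun t => siegelMap lam (linAct lam t z)) t) := by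
  refine (injective_iff_map_eq_zero _).2 fun s hs => ?_
  have hd : HasFDerivAt (fun t => siegelMap lam (linAct lam t z))
      (fderiv ℝ (fun t => siegelMap lam (linAct lam t z)) t) t :=
    ((contDiff_siegelMap_linAct (m := 1)).comp (contDiff_const.prodMk contDiff_id)
      |>.differentiable one_ne_zero t).hasFDerivAt
  have hline : HasDerivAt (fun r : ℝ => t + r • s) s 0 := by
    simpa using ((hasDerivAt_id (0 : ℝ)).smul_const s).const_add t
  have h1 : HasDerivAt (fun r : ℝ => siegelMap lam (linAct lam (t + r • s) z)) 0 0 := by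
    have := HasFDerivAt.comp_hasDerivAt (x := (0 : ℝ)) (f := fun r : ℝ => t + r • s)
      (l := fun t => siegelMap lam (linAct lam t z)) (by simpa using hd) hline
    rwa [hs] at this
  let P : Cn k →L[ℂ] ℂ := ∑ j, s j • (EuclideanSpace.proj j : Cn k →L[ℂ] ℂ)
  have hP : ∀ v, P v = ∑ j, s j * v j := fun v => by simp [P]
  let w := linAct lam t z
  have hval : ∀ r : ℝ, (P (siegelMap lam (linAct lam (t + r • s) z))).re =
      ∑ i, ‖w i‖ ^ 2 * (weight lam i s).re * Real.exp (r * (2 * (weight lam i s).re)) := by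
    intro r
    rw [add_comm, linAct_add]
    have h2 : P (siegelMap lam (linAct lam (r • s) w)) =
        ∑ i, ((‖linAct lam (r • s) w i‖ ^ 2 : ℝ) : ℂ) * weight lam i s := by
      simp only [hP, weight_apply, siegelMap, Finset.mul_sum]
      rw [Finset.sum_comm]
      exact Finset.sum_congr rfl fun i _ => Finset.sum_congr rfl fun j _ => by ring
    rw [h2, Complex.re_sum]
    refine Finset.sum_congr rfl fun i _ => ?_
    rw [Complex.re_ofReal_mul, linAct_apply, norm_mul, Complex.norm_exp, mul_pow,
      ← Real.exp_nat_mul, ← Complex.coe_smul, map_smul, smul_eq_mul, Complex.re_ofReal_mul]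
    push_cast
    simp only [w]
    ring_nf
  have h3 : HasDerivAt (fun r : ℝ => (P (siegelMap lam (linAct lam (t + r • s) z))).re) 0 0 := by
    have h2 := (Complex.reCLM.comp (P.restrictScalars ℝ)).hasFDerivAt.comp_hasDerivAt (0 : ℝ) h1
    rw [map_zero] at h2
    exact h2
  simp only [hval] at h3
  have h4 : HasDerivAt
      (fun r : ℝ => ∑ i, ‖w i‖ ^ 2 * (weight lam i s).re * Real.exp (r * (2 * (weight lam i s).re)))
      (∑ i, ‖w i‖ ^ 2 * (weight lam i s).re * (Real.exp (0 * (2 * (weight lam i s).re)) *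
          (1 * (2 * (weight lam i s).re)))) 0 :=
    HasDerivAt.fun_sum fun i _ =>
      (((hasDerivAt_id (0 : ℝ)).mul_const _).exp).const_mul _
  have h5 := h4.unique h3
  have h6 := (Finset.sum_eq_zero_iff_of_nonneg fun i _ => by
    have : 0 ≤ ‖w i‖ ^ 2 * ((weight lam i s).re * (weight lam i s).re) :=
      mul_nonneg (by positivity) (mul_self_nonneg _)
    simp only [zero_mul, Real.exp_zero, one_mul]
    linarith).1 h5
  refine h.eq_zero_of_mem_siegelStar hkn ht fun i hi => ?_
  have h7 := h6 i (Finset.mem_univ _)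
  have h8 : ‖w i‖ ≠ 0 := norm_ne_zero_iff.2 hi
  simpa [h8] using h7

theorem exists_mem_siegelStar (h : InSiegelDomain lam) : ∃ z, z ∈ siegelStar lam := by
  rw [InSiegelDomain, ← Set.image_univ] at h
  obtain ⟨c, hc0, hcne, -, hc⟩ := exists_weights_of_zero_mem_convexHull h
  have hsq : ∀ i, ‖((√(c i) : ℝ) : ℂ)‖ ^ 2 = c i := fun i => by
    rw [Complex.norm_real, Real.norm_of_nonneg (Real.sqrt_nonneg _), Real.sq_sqrt (hc0 i)]
  -- Taking `z_i = √c_i` turns `Ψ z` into the vanishing combination.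
  refine ⟨WithLp.toLp 2 fun i => ((√(c i) : ℝ) : ℂ), ?_, fun h0 => hcne ?_⟩
  · ext j
    rw [siegelMap_apply_eq_sum]
    simp only [hsq]
    exact hc j
  · ext i
    have h1 : ((√(c i) : ℝ) : ℂ) = 0 := congrArg (fun v : Cn n => v i) h0
    rw [← hsq i, h1]
    simp

theorem siegelMap_smul (r : ℝ) (z : Cn n) :
    siegelMap lam (r • z) = (r ^ 2) • siegelMap lam z := by
  ext j
  simp only [siegelMap, PiLp.smul_apply, Complex.real_smul, norm_mul, Complex.norm_real, mul_pow,
    Real.norm_eq_abs, sq_abs, Finset.mul_sum]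
  push_cast
  exact Finset.sum_congr rfl fun i _ => by ring

theorem siegelMap_zero : siegelMap lam 0 = 0 := by
  simpa using siegelMap_smul (lam := lam) 0 0

/-- `Ψ` is homogeneous of degree two over the reals, so its zero set contains the real line through
any point of `𝒯*`. -/
theorem dimH_zeroSet_pos (h : InSiegelDomain lam) {U : Set (Cn n)} (hU : U ∈ 𝓝 (0 : Cn n)) :
    0 < dimH (mixedZeroSet (siegelMap lam) ∩ U) := by
  obtain ⟨w, hw, hw0⟩ := exists_mem_siegelStar h
  let L : ℝ →ₗ[ℝ] Cn n := LinearMap.toSpanSingleton ℝ (Cn n) w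
  obtain ⟨K, -, hK⟩ := L.exists_antilipschitzWith (LinearMap.ker_toSpanSingleton ℝ hw0)
  have hcont : Continuous L := by
    change Continuous fun r : ℝ => r • w
    fun_prop
  have hnhds : L ⁻¹' U ∈ 𝓝 (0 : ℝ) := hcont.continuousAt.preimage_mem_nhds (by simpa using hU)
  have hdim : dimH (L ⁻¹' U) = 1 := by
    rw [Real.dimH_of_mem_nhds hnhds]
    simp
  have hsub : L '' (L ⁻¹' U) ⊆ mixedZeroSet (siegelMap lam) ∩ U := by
    rintro _ ⟨r, hr, rfl⟩
    refine ⟨?_, hr⟩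
    change siegelMap lam (r • w) = 0
    rw [siegelMap_smul, show siegelMap lam w = 0 from hw, smul_zero]
  calc (0 : ENNReal) < dimH (L ⁻¹' U) := by rw [hdim]; exact zero_lt_one
    _ ≤ dimH (L '' (L ⁻¹' U)) := hK.le_dimH_image _
    _ ≤ _ := dimH_mono hsub

/-- `Ψ` is even. -/
theorem fderiv_siegelMap_zero : fderiv ℝ (siegelMap lam) 0 = 0 := by
  have heven : (fun z => siegelMap lam (-z)) = siegelMap lam := by
    ext1 z
    simpa using siegelMap_smul (lam := lam) (-1) z
  have hd : HasFDerivAt (siegelMap lam) (fderiv ℝ (siegelMap lam) 0) (-0) := by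
    rw [neg_zero]
    exact ((contDiff_siegelMap (m := 1)).differentiable one_ne_zero 0).hasFDerivAt
  have h1 := (hd.comp (0 : Cn n) (hasFDerivAt_id (𝕜 := ℝ) (0 : Cn n)).neg).fderiv
  have h2 : fderiv ℝ (siegelMap lam) 0 = -fderiv ℝ (siegelMap lam) 0 := by
    conv_lhs => rw [← heven]
    refine h1.trans ?_
    ext1 x
    simp
  ext x j
  have h3 := congrArg (fun A : Cn n →L[ℝ] Cn k => A x j) h2
  exact self_eq_neg.1 h3

/-- The `2k` real orbit directions already have independent images. -/
theorem IsWeaklyHyperbolic.le_finrank_range_fderiv (hkn : 2 * k ≤ n)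
    (h : IsWeaklyHyperbolic lam) {z : Cn n} (hz : z ∈ siegelStar lam) :
    2 * k ≤ Module.finrank ℝ (LinearMap.range (fderiv ℝ (siegelMap lam) z).toLinearMap) := by
  have hinj := h.injective_fderiv_siegelMap_linAct hkn (z := z) (t := 0) (by rwa [linAct_zero])
  have hd1 : DifferentiableAt ℝ (fun t => linAct lam t z) 0 :=
    (contDiffAt_linAct_real (m := 1) contDiffAt_id contDiffAt_const).differentiableAt one_ne_zero
  have hd2 : DifferentiableAt ℝ (siegelMap lam) (linAct lam 0 z) :=
    (contDiff_siegelMap (m := 1)).differentiable one_ne_zero _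
  have hcomp := fderiv_comp (𝕜 := ℝ) (0 : Cn k) hd2 hd1
  rw [linAct_zero] at hcomp
  have hdim : Module.finrank ℝ (Cn k) = 2 * k := by
    rw [finrank_real_of_complex]; simp
  rw [← hdim, ← LinearMap.finrank_range_of_inj hinj]
  refine Submodule.finrank_mono ?_
  rintro _ ⟨s, rfl⟩
  exact ⟨fderiv ℝ (fun t => linAct lam t z) 0 s, (congrArg (fun A => A s) hcomp).symm⟩

theorem isMixedICIS_siegelMap (hk : 0 < k) (hkn : 2 * k < n) (h : IsAdmissible lam) :
    IsMixedICIS (siegelMap lam) where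
  isMixedMap := isMixedMap_siegelMap
  map_zero := siegelMap_zero
  lt := by omega
  zeroSet_pos_dim _ hU := dimH_zeroSet_pos h.siegel hU
  critical_inter_zeroSet := by
    ext z
    constructor
    · rintro ⟨hz, hz0⟩
      by_contra hne
      have h1 := h.weaklyHyperbolic.le_finrank_range_fderiv hkn.le (z := z) ⟨hz0, hne⟩
      have h2 : _ < min (2 * n) (2 * k) := hz
      omega
    · rintro rfl
      refine ⟨?_, siegelMap_zero⟩
      have h1 : LinearMap.range (fderiv ℝ (siegelMap lam) 0).toLinearMap = ⊥ := by
        rw [fderiv_siegelMap_zero]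
        exact LinearMap.range_zero
      change Module.finrank ℝ (LinearMap.range (fderiv ℝ (siegelMap lam) 0).toLinearMap) < _
      rw [h1, finrank_bot]
      omega

/-- Implicit function theorem for `Ψ (t · y) = 0`: the partial derivative in `t` is an injective
real endomorphism of `ℂᵏ`, hence invertible. -/
theorem IsWeaklyHyperbolic.exists_contDiffAt_linAct_mem_siegelStar (hkn : 2 * k ≤ n)
    (h : IsWeaklyHyperbolic lam) {z : Cn n} {t : Cn k} (ht : linAct lam t z ∈ siegelStar lam) :
    ∃ g : Cn n → Cn k, ContDiffAt ℝ ω g z ∧ ∀ᶠ y in 𝓝 z, linAct lam (g y) y ∈ siegelStar lam := by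
  have hsm : ContDiffAt ℝ ω (fun p : Cn n × Cn k => siegelMap lam (linAct lam p.2 p.1)) (z, t) :=
    contDiff_siegelMap_linAct.contDiffAt
  have hcomp : fderiv ℝ (fun t => siegelMap lam (linAct lam t z)) t =
      fderiv ℝ (fun p : Cn n × Cn k => siegelMap lam (linAct lam p.2 p.1)) (z, t) ∘L
        .inr ℝ (Cn n) (Cn k) :=
    ((hsm.differentiableAt (by simp)).hasFDerivAt.comp t (hasFDerivAt_prodMk_right z t)).fderiv
  have hinj := h.injective_fderiv_siegelMap_linAct hkn ht
  have hinv : (fderiv ℝ (fun p : Cn n × Cn k => siegelMap lam (linAct lam p.2 p.1)) (z, t) ∘L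
        .inr ℝ (Cn n) (Cn k)).IsInvertible := by
    rw [← hcomp]
    refine ⟨(LinearEquiv.ofInjectiveEndo _ hinj).toContinuousLinearEquiv, ?_⟩
    ext1 x
    rfl
  refine ⟨hsm.implicitFunction (by simp) hinv, hsm.contDiffAt_implicitFunction (by simp) hinv, ?_⟩
  have hz : z ≠ 0 := fun h0 => ht.2 ((linAct_eq_zero lam).2 h0)
  filter_upwards [hsm.eventually_apply_implicitFunction (by simp) hinv, isOpen_ne.mem_nhds hz]
    with y hy hy0
  exact ⟨hy.trans ht.1, fun h0 => hy0 ((linAct_eq_zero lam).1 h0)⟩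

end

/-! ### The projection along leaves and foliated charts -/

section

variable {n k : ℕ} (lam : Matrix (Fin n) (Fin k) ℂ)

open Classical in
/-- A parameter `t` that moves `z` into `𝒯*`, if there is one. -/
noncomputable def siegelTime (z : Cn n) : Cn k :=
  if h : ∃ t, linAct lam t z ∈ siegelStar lam then h.choose else 0

/-- The point of `𝒯*` on the leaf of a point of a Siegel leaf. -/
noncomputable def siegelRetr (z : Cn n) : Cn n :=
  linAct lam (siegelTime lam z) z

open Classical in
/-- The projection of `ℂⁿ` to `𝒯*` along the Siegel leaves, constant elsewhere. -/
noncomputable def siegelProj (w : siegelStar lam) (z : Cn n) : siegelStar lam :=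
  if h : siegelRetr lam z ∈ siegelStar lam then ⟨siegelRetr lam z, h⟩ else w

variable {lam}

theorem siegelRetr_mem_of_exists {z : Cn n} (hz : ∃ t, linAct lam t z ∈ siegelStar lam) :
    siegelRetr lam z ∈ siegelStar lam := by
  rw [siegelRetr, siegelTime, dif_pos hz]
  exact hz.choose_spec

variable (hkn : 2 * k ≤ n) (h : IsWeaklyHyperbolic lam)
include hkn h

/-- Freeness makes the choice in `siegelTime` unique, so any local solution of the implicit equation
coincides with it. -/
theorem siegelTime_eq {z : Cn n} {t : Cn k} (ht : linAct lam t z ∈ siegelStar lam) :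
    siegelTime lam z = t := by
  have h1 := siegelRetr_mem_of_exists ⟨t, ht⟩
  refine sub_eq_zero.1 (h.eq_zero_of_linAct_mem_siegelStar hkn ht ?_)
  rwa [← linAct_add, sub_add_cancel]

theorem siegelRetr_mem {z : Cn n} (hz : z ∈ siegelSet lam) :
    siegelRetr lam z ∈ siegelStar lam :=
  siegelRetr_mem_of_exists (h.exists_linAct_mem_siegelStar hkn hz)

theorem coe_siegelProj (w : siegelStar lam) {z : Cn n} (hz : z ∈ siegelSet lam) :
    (siegelProj lam w z : Cn n) = siegelRetr lam z := by
  rw [siegelProj, dif_pos (siegelRetr_mem hkn h hz)]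

theorem siegelTime_of_mem_siegelStar {z : Cn n} (hz : z ∈ siegelStar lam) :
    siegelTime lam z = 0 :=
  siegelTime_eq hkn h (by rwa [linAct_zero])

theorem siegelRetr_of_mem_siegelStar {z : Cn n} (hz : z ∈ siegelStar lam) :
    siegelRetr lam z = z := by
  rw [siegelRetr, siegelTime_of_mem_siegelStar hkn h hz, linAct_zero]

theorem siegelTime_linAct {z : Cn n} (hz : z ∈ siegelSet lam) (s : Cn k) :
    siegelTime lam (linAct lam s z) = siegelTime lam z - s := by
  refine siegelTime_eq hkn h ?_
  rw [← linAct_add, sub_add_cancel]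
  exact siegelRetr_mem hkn h hz

theorem siegelRetr_linAct {z : Cn n} (hz : z ∈ siegelSet lam) (s : Cn k) :
    siegelRetr lam (linAct lam s z) = siegelRetr lam z := by
  rw [siegelRetr, siegelTime_linAct hkn h hz, ← linAct_add, sub_add_cancel, siegelRetr]

/-- All nearby leaves meet `𝒯*`, and leaves through `𝒯*` are Siegel. -/
theorem siegelSet_mem_nhds {z : Cn n} (hz : z ∈ siegelSet lam) : siegelSet lam ∈ 𝓝 z := by
  obtain ⟨g, -, hg⟩ := h.exists_contDiffAt_linAct_mem_siegelStar hkn (siegelRetr_mem hkn h hz)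
  filter_upwards [hg] with y hy
  exact (linAct_mem_siegelSet lam).1 (siegelStar_subset_siegelSet hy)

theorem isOpen_siegelSet : IsOpen (siegelSet lam) :=
  isOpen_iff_mem_nhds.2 fun _ hz => siegelSet_mem_nhds hkn h hz

theorem contDiffAt_siegelTime {z : Cn n} (hz : z ∈ siegelSet lam) :
    ContDiffAt ℝ ω (siegelTime lam) z := by
  obtain ⟨g, hg1, hg⟩ := h.exists_contDiffAt_linAct_mem_siegelStar hkn (siegelRetr_mem hkn h hz)
  refine hg1.congr_of_eventuallyEq ?_
  filter_upwards [hg] with y hy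
  exact siegelTime_eq hkn h hy

theorem contDiffAt_siegelRetr {z : Cn n} (hz : z ∈ siegelSet lam) :
    ContDiffAt ℝ ω (siegelRetr lam) z :=
  contDiffAt_linAct_real (contDiffAt_siegelTime hkn h hz) contDiffAt_id

theorem continuousOn_siegelProj (w : siegelStar lam) :
    ContinuousOn (siegelProj lam w) (siegelSet lam) := by
  rw [Topology.IsInducing.subtypeVal.continuousOn_iff]
  refine ContinuousOn.congr (f := siegelRetr lam) (fun z hz =>
    (contDiffAt_siegelRetr hkn h hz).continuousAt.continuousWithinAt) fun z hz => ?_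
  exact coe_siegelProj hkn h w hz

omit hkn h in
variable (lam) in
/-- The differential at `0` of the orbit map `t ↦ t · w`. -/
noncomputable def orbitDeriv (w : Cn n) : Cn k →L[ℂ] Cn n :=
  (EuclideanSpace.equiv (Fin n) ℂ).symm.toContinuousLinearMap ∘L
    ContinuousLinearMap.pi fun i => w i • weight lam i

omit hkn h in
theorem orbitDeriv_apply (w : Cn n) (t : Cn k) (i : Fin n) :
    orbitDeriv lam w t i = w i * weight lam i t := rfl

theorem injective_orbitDeriv {w : Cn n} (hw : w ∈ siegelStar lam) :
    Function.Injective (orbitDeriv lam w) := by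
  refine (injective_iff_map_eq_zero _).2 fun t ht => ?_
  refine h.eq_zero_of_mem_siegelStar hkn hw fun i hi => ?_
  have h1 : w i * weight lam i t = 0 := congrArg (fun v : Cn n => v i) ht
  rw [(mul_eq_zero.1 h1).resolve_left hi, Complex.zero_re]

omit h in
/-- An injective linear map `ℂᵏ → ℂⁿ` has a complementary linear map `ℂⁿ⁻ᵏ → ℂⁿ`. -/
theorem exists_coprod_eq_continuousLinearEquiv {L : Cn k →L[ℂ] Cn n} (hL : Function.Injective L) :
    ∃ (B : Cn (n - k) →L[ℂ] Cn n) (e : (Cn k × Cn (n - k)) ≃L[ℂ] Cn n),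
      (e : (Cn k × Cn (n - k)) →L[ℂ] Cn n) = L.coprod B := by
  obtain ⟨N, hN⟩ := Submodule.exists_isCompl (LinearMap.range L.toLinearMap)
  have hr : Module.finrank ℂ (LinearMap.range L.toLinearMap) = k := by
    rw [LinearMap.finrank_range_of_inj hL]; simp
  have hfr : Module.finrank ℂ (Cn (n - k)) = Module.finrank ℂ N := by
    have h1 := Submodule.finrank_add_eq_of_isCompl hN
    rw [hr] at h1
    simp at h1 ⊢
    omega
  let b : Cn (n - k) ≃ₗ[ℂ] N := LinearEquiv.ofFinrankEq _ _ hfr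
  let B : Cn (n - k) →L[ℂ] Cn n := LinearMap.toContinuousLinearMap (N.subtype ∘ₗ b.toLinearMap)
  have hB : ∀ x, B x = b x := fun x => rfl
  have hinj : Function.Injective (L.coprod B).toLinearMap := by
    refine (injective_iff_map_eq_zero _).2 fun p hp => ?_
    have hp' : L p.1 + B p.2 = 0 := hp
    have h1 : B p.2 ∈ LinearMap.range L.toLinearMap :=
      ⟨-p.1, by simpa using neg_eq_of_add_eq_zero_right hp'⟩
    have h2 : B p.2 = 0 :=
      (Submodule.disjoint_def.1 hN.disjoint) _ h1 (by rw [hB]; exact (b p.2).2)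
    have h3 : p.2 = 0 := by
      rw [hB] at h2
      simpa using h2
    rw [h2, add_zero] at hp'
    exact Prod.ext ((injective_iff_map_eq_zero L).1 hL _ hp') h3
  have hdim : Module.finrank ℂ (Cn k × Cn (n - k)) = Module.finrank ℂ (Cn n) := by
    simp
    omega
  exact ⟨B, (LinearEquiv.ofInjectiveOfFinrankEq _ hinj hdim).toContinuousLinearEquiv,
    ContinuousLinearMap.ext fun _ => rfl⟩

omit hkn h in
variable (lam) in
/-- A holomorphic chart of `ℂⁿ` near `w` of the form `(t, x) ↦ t · (w + B x)`, in which the leaves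
are the slices `x = const`. -/
structure FoliatedChart (w : Cn n) where
  /-- The linear parametrization of a transversal. -/
  dir : Cn (n - k) →L[ℂ] Cn n
  /-- The inverse of the chart. -/
  param : OpenPartialHomeomorph (Cn k × Cn (n - k)) (Cn n)
  param_apply : ∀ p, param p = linAct lam p.1 (w + dir p.2)
  mem_target : w ∈ param.target
  contDiffAt_symm : ∀ z ∈ param.target, ContDiffAt ℂ ω param.symm z

/-- At `0` the map `(t, x) ↦ t · (w + B x)` has differential `orbitDeriv` on the first factor and a
complement `B` of its range on the second, so the inverse function theorem applies. -/
theorem nonempty_foliatedChart {w : Cn n} (hw : w ∈ siegelStar lam) :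
    Nonempty (FoliatedChart lam w) := by
  obtain ⟨B, e, he⟩ := exists_coprod_eq_continuousLinearEquiv hkn (injective_orbitDeriv hkn h hw)
  let f : Cn k × Cn (n - k) → Cn n := fun p => linAct lam p.1 (w + B p.2)
  have hf : ContDiffAt ℂ ω f 0 := contDiffAt_linAct contDiffAt_fst
    (contDiffAt_const.add (B.contDiff.contDiffAt.comp _ contDiffAt_snd))
  have hf0 : f 0 = w := by simp [f, linAct_zero]
  have hd : HasFDerivAt f (e : (Cn k × Cn (n - k)) →L[ℂ] Cn n) 0 := by
    rw [he, ← hasFDerivWithinAt_univ, hasFDerivWithinAt_piLp]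
    intro i
    have h1 : HasFDerivAt (fun p : Cn k × Cn (n - k) => weight lam i p.1)
        (weight lam i ∘L .fst ℂ _ _) 0 :=
      (weight lam i).hasFDerivAt.comp _ hasFDerivAt_fst
    have h2 : HasFDerivAt (fun p : Cn k × Cn (n - k) => w i + B p.2 i)
        ((EuclideanSpace.proj i : Cn n →L[ℂ] ℂ) ∘L B ∘L .snd ℂ _ _) 0 :=
      ((EuclideanSpace.proj i : Cn n →L[ℂ] ℂ).hasFDerivAt.comp _
        (B.hasFDerivAt.comp _ hasFDerivAt_snd)).const_add _
    have h3 := h1.cexp.mul h2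
    simp only [f, linAct_apply]
    refine (h3.congr_fderiv (ContinuousLinearMap.ext fun p => ?_)).hasFDerivWithinAt
    simp [orbitDeriv_apply, add_comm]
  let q := hf.toOpenPartialHomeomorph f hd (by simp)
  have hqw : w ∈ q.target := hf0 ▸ hf.image_mem_toOpenPartialHomeomorph_target hd (by simp)
  have hqs : AnalyticAt ℂ q.symm w := by
    have := (hf.to_localInverse hd (by simp)).analyticAt
    rwa [hf0] at this
  -- The inverse is known to be analytic only at `w`; the target is cut down to the open set where
  -- it is analytic.
  let q' := (q.symm.restrOpen {z | AnalyticAt ℂ q.symm z} (isOpen_analyticAt ℂ q.symm)).symm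
  exact ⟨{
    dir := B
    param := q'
    param_apply := fun _ => rfl
    mem_target := ⟨hqw, hqs⟩
    contDiffAt_symm := fun z hz => AnalyticAt.contDiffAt hz.2 }⟩

end

/-! ### Transversal coordinates and charts of `𝒯*` -/

section

variable {n k : ℕ} {lam : Matrix (Fin n) (Fin k) ℂ}

namespace FoliatedChart

variable {w : Cn n} (c : FoliatedChart lam w)

/-- The transversal coordinate `x` of the point `t · (w + B x)`. -/
noncomputable def coord (z : Cn n) : Cn (n - k) := (c.param.symm z).2

theorem contDiffAt_coord {z : Cn n} (hz : z ∈ c.param.target) : ContDiffAt ℂ ω c.coord z :=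
  contDiffAt_snd.comp z (c.contDiffAt_symm z hz)

theorem linAct_coord {z : Cn n} (hz : z ∈ c.param.target) :
    linAct lam (c.param.symm z).1 (w + c.dir (c.coord z)) = z := by
  rw [coord, ← c.param_apply, c.param.right_inv hz]

/-- The differential of the transversal coordinate is onto, also after a translation by the
action. -/
theorem surjective_fderiv_coord_linAct {t : Cn k} {z : Cn n} (hz : linAct lam t z ∈ c.param.target) :
    Function.Surjective (fderiv ℂ (fun y => c.coord (linAct lam t y)) z) := by
  set p := c.param.symm (linAct lam t z) with hp
  -- A local right inverse: vary `x` at a fixed time, then undo the translation by `t`.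
  let φ : Cn (n - k) → Cn n := fun x => linAct lam (-t) (c.param (p.1, x))
  have hφ : DifferentiableAt ℂ φ p.2 := by
    simp only [φ, c.param_apply]
    exact (contDiffAt_linAct (m := 1) contDiffAt_const (contDiffAt_linAct contDiffAt_const
      (contDiffAt_const.add c.dir.contDiff.contDiffAt))).differentiableAt one_ne_zero
  have hφ0 : φ p.2 = z := by
    simp only [φ, hp, Prod.mk.eta, c.param.right_inv hz, linAct_neg_linAct]
  have hact : ∀ x, linAct lam t (φ x) = c.param (p.1, x) := fun x => by
    simpa using linAct_neg_linAct lam (-t) (c.param (p.1, x))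
  have hg : DifferentiableAt ℂ (fun y => c.coord (linAct lam t y)) (φ p.2) := by
    rw [hφ0]
    exact ((c.contDiffAt_coord hz).comp z (contDiffAt_linAct contDiffAt_const contDiffAt_id)
      |>.differentiableAt (by simp))
  have hid : (fun y => c.coord (linAct lam t y)) ∘ φ =ᶠ[𝓝 p.2] id := by
    have hmem : ∀ᶠ x in 𝓝 p.2, (p.1, x) ∈ c.param.source :=
      (Continuous.prodMk_right p.1).continuousAt.preimage_mem_nhds
        (c.param.open_source.mem_nhds (c.param.map_target hz))
    filter_upwards [hmem] with x hx
    simp only [Function.comp_apply, hact, coord, c.param.left_inv hx, id]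
  have hcomp := (hg.hasFDerivAt.comp p.2 hφ.hasFDerivAt).fderiv
  rw [hid.fderiv_eq, fderiv_id, hφ0] at hcomp
  intro v
  exact ⟨fderiv ℂ φ p.2 v, (congrArg (fun A => A v) hcomp).symm⟩

variable (hkn : 2 * k ≤ n) (h : IsWeaklyHyperbolic lam)
include hkn h

/-- The transversal coordinate of the projection to `𝒯*` is locally that of a fixed translate. -/
theorem coord_siegelRetr_eventuallyEq {z : Cn n} (hz : z ∈ siegelSet lam)
    (hzc : siegelRetr lam z ∈ c.param.target) :
    (fun y => c.coord (siegelRetr lam y)) =ᶠ[𝓝 z]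
      fun y => c.coord (linAct lam (siegelTime lam z) y) := by
  set t := siegelTime lam z with ht
  have hact : ContinuousAt (fun y => linAct lam t y) z :=
    (contDiffAt_linAct_real (m := 0) contDiffAt_const contDiffAt_id).continuousAt
  have htime : ContinuousAt (siegelTime lam) z := (contDiffAt_siegelTime hkn h hz).continuousAt
  have hsymm : ContinuousAt (fun y => c.param.symm (linAct lam t y)) z :=
    ContinuousAt.comp (f := fun y => linAct lam t y) (c.param.symm.continuousAt hzc) hact
  have hsrc : ∀ᶠ y in 𝓝 z, (siegelTime lam y - t + (c.param.symm (linAct lam t y)).1,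
      c.coord (linAct lam t y)) ∈ c.param.source := by
    refine (((htime.sub continuousAt_const).add hsymm.fst).prodMk hsymm.snd).preimage_mem_nhds
      (c.param.open_source.mem_nhds ?_)
    change (t - t + (c.param.symm (linAct lam t z)).1, (c.param.symm (linAct lam t z)).2) ∈
      c.param.source
    rw [sub_self, zero_add]
    exact c.param.map_target hzc
  filter_upwards [hsrc, hact.preimage_mem_nhds (c.param.open_target.mem_nhds hzc)] with y hy1 hy2
  -- `siegelRetr lam y` is `t · y` moved by the small time `siegelTime lam y - t`, which changes
  -- only the first coordinate of the chart.
  have h1 : c.param (siegelTime lam y - t + (c.param.symm (linAct lam t y)).1,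
      c.coord (linAct lam t y)) = siegelRetr lam y := by
    rw [c.param_apply, linAct_add, c.linAct_coord hy2, ← linAct_add, sub_add_cancel, siegelRetr]
  change c.coord (siegelRetr lam y) = _
  rw [← h1, coord, c.param.left_inv hy1]

/-- Freezing the real analytic `siegelTime` at its value at `z` leaves a holomorphic map. -/
theorem contDiffAt_coord_siegelRetr {z : Cn n} (hz : z ∈ siegelSet lam)
    (hzc : siegelRetr lam z ∈ c.param.target) :
    ContDiffAt ℂ ω (fun y => c.coord (siegelRetr lam y)) z := by
  have h1 : ContDiffAt ℂ ω (fun y => linAct lam (siegelTime lam z) y) z :=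
    contDiffAt_linAct contDiffAt_const contDiffAt_id
  have h2 : ContDiffAt ℂ ω c.coord (linAct lam (siegelTime lam z) z) := c.contDiffAt_coord hzc
  exact (ContDiffAt.comp (g := c.coord) z h2 h1).congr_of_eventuallyEq
    (c.coord_siegelRetr_eventuallyEq hkn h hz hzc)

theorem surjective_fderiv_coord_siegelRetr {z : Cn n} (hz : z ∈ siegelSet lam)
    (hzc : siegelRetr lam z ∈ c.param.target) :
    Function.Surjective (fderiv ℂ (fun y => c.coord (siegelRetr lam y)) z) := by
  rw [(c.coord_siegelRetr_eventuallyEq hkn h hz hzc).fderiv_eq]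
  exact c.surjective_fderiv_coord_linAct hzc

theorem add_dir_coord {z : Cn n} (hzc : z ∈ c.param.target) (hz : z ∈ siegelStar lam) :
    w + c.dir (c.coord z) ∈ siegelSet lam ∧
      siegelTime lam (w + c.dir (c.coord z)) = (c.param.symm z).1 ∧
      siegelRetr lam (w + c.dir (c.coord z)) = z := by
  have h1 := c.linAct_coord hzc
  have h2 : siegelTime lam (w + c.dir (c.coord z)) = (c.param.symm z).1 :=
    siegelTime_eq hkn h (by rw [h1]; exact hz)
  refine ⟨(linAct_mem_siegelSet lam (t := (c.param.symm z).1)).1 ?_, h2, ?_⟩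
  · rw [h1]
    exact siegelStar_subset_siegelSet hz
  rw [siegelRetr, h2, h1]

omit hkn h in
theorem siegelRetr_add_dir {x : Cn (n - k)}
    (hx : (siegelTime lam (w + c.dir x), x) ∈ c.param.source) :
    siegelRetr lam (w + c.dir x) ∈ c.param.target ∧ c.coord (siegelRetr lam (w + c.dir x)) = x := by
  have h1 : siegelRetr lam (w + c.dir x) = c.param (siegelTime lam (w + c.dir x), x) := by
    rw [c.param_apply, siegelRetr]
  rw [h1]
  exact ⟨c.param.map_source hx, by rw [coord, c.param.left_inv hx]⟩

/-- The chart of `𝒯*` given by the transversal coordinate. -/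
noncomputable def starChart (w₀ : siegelStar lam) :
    OpenPartialHomeomorph (siegelStar lam) (Cn (n - k)) where
  toFun z := c.coord z
  -- The transversal point slides along its leaf to `𝒯*`; the target requires that it arrive inside
  -- the chart with the same `x`.
  invFun x := siegelProj lam w₀ (w + c.dir x)
  source := Subtype.val ⁻¹' c.param.target
  target := {x | w + c.dir x ∈ siegelSet lam ∧ (siegelTime lam (w + c.dir x), x) ∈ c.param.source}
  map_source' z hz := by
    obtain ⟨h1, h2, -⟩ := c.add_dir_coord hkn h hz z.2
    refine ⟨h1, ?_⟩
    rw [h2]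
    exact c.param.map_target hz
  map_target' x hx := by
    change (siegelProj lam w₀ (w + c.dir x) : Cn n) ∈ c.param.target
    rw [coe_siegelProj hkn h _ hx.1]
    exact (c.siegelRetr_add_dir hx.2).1
  left_inv' z hz := by
    obtain ⟨h1, -, h3⟩ := c.add_dir_coord hkn h hz z.2
    refine Subtype.ext ?_
    rw [coe_siegelProj hkn h _ h1, h3]
  right_inv' x hx := by
    rw [coe_siegelProj hkn h _ hx.1]
    exact (c.siegelRetr_add_dir hx.2).2
  open_source := c.param.open_target.preimage continuous_subtype_val
  open_target := by
    have hdir : Continuous fun x => w + c.dir x := continuous_const.add c.dir.continuous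
    have hcont : ContinuousOn (fun x => (siegelTime lam (w + c.dir x), x))
        ((fun x => w + c.dir x) ⁻¹' siegelSet lam) := fun x hx =>
      (((contDiffAt_siegelTime hkn h hx).continuousAt.comp
        (f := fun x => w + c.dir x) hdir.continuousAt).prodMk continuousAt_id).continuousWithinAt
    exact hcont.isOpen_inter_preimage ((isOpen_siegelSet hkn h).preimage hdir) c.param.open_source
  continuousOn_toFun z hz :=
    ((c.contDiffAt_coord hz).continuousAt.comp continuous_subtype_val.continuousAt
      ).continuousWithinAt
  continuousOn_invFun :=
    (continuousOn_siegelProj hkn h w₀).comp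
      (continuous_const.add c.dir.continuous).continuousOn fun _ hx => hx.1

end FoliatedChart

end

/-! ### The leaf space and the complex structure of `𝒯*` -/

section

variable {n k : ℕ} {lam : Matrix (Fin n) (Fin k) ℂ}

/-- The map from `𝒯*` to the space of Siegel leaves is a homeomorphism. -/
theorem isHomeomorph_siegelLeafSpace (hkn : 2 * k ≤ n) (h : IsWeaklyHyperbolic lam)
    (w₀ : siegelStar lam) (hsub : siegelStar lam ⊆ siegelSet lam) :
    IsHomeomorph (fun z : siegelStar lam =>
      (Quotient.mk _ ⟨z, hsub z.2⟩ : SiegelLeafSpace lam)) := by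
  have hproj : ∀ z y : siegelSet lam, leaf lam (z : Cn n) = leaf lam (y : Cn n) →
      siegelProj lam w₀ z = siegelProj lam w₀ y := by
    intro z y hzy
    obtain ⟨t, ht⟩ : (z : Cn n) ∈ leaf lam (y : Cn n) := hzy ▸ mem_leaf_self lam (z : Cn n)
    refine Subtype.ext ?_
    rw [coe_siegelProj hkn h _ z.2, coe_siegelProj hkn h _ y.2, ← ht]
    exact siegelRetr_linAct hkn h y.2 t
  refine isHomeomorph_iff_exists_inverse.2 ⟨?_, ?_⟩
  · exact continuous_quotient_mk'.comp (continuous_subtype_val.subtype_mk _)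
  refine ⟨Quotient.lift (fun z : siegelSet lam => siegelProj lam w₀ z) hproj, ?_, ?_, ?_⟩
  · intro z
    refine Subtype.ext ?_
    change (siegelProj lam w₀ z : Cn n) = z
    rw [coe_siegelProj hkn h _ (hsub z.2), siegelRetr_of_mem_siegelStar hkn h z.2]
  · intro q
    induction q using Quotient.inductionOn with
    | h z =>
      refine Quotient.sound ?_
      change leaf lam (siegelProj lam w₀ z : Cn n) = leaf lam z
      rw [coe_siegelProj hkn h _ z.2]
      exact leaf_linAct lam _ _
  · exact Continuous.quotient_lift
      (continuousOn_iff_continuous_domRestrict.1 (continuousOn_siegelProj hkn h w₀)) hproj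

/-- A foliated chart at a point of `𝒯*`. -/
noncomputable def foliatedChartAt (hkn : 2 * k ≤ n) (h : IsWeaklyHyperbolic lam)
    (w : siegelStar lam) : FoliatedChart lam (w : Cn n) :=
  (nonempty_foliatedChart hkn h w.2).some

/-- The chart of `𝒯*` at one of its points. -/
noncomputable def starChartAt (hkn : 2 * k ≤ n) (h : IsWeaklyHyperbolic lam)
    (w : siegelStar lam) : OpenPartialHomeomorph (siegelStar lam) (Cn (n - k)) :=
  (foliatedChartAt hkn h w).starChart hkn h w

/-- The complex atlas of `𝒯*`. -/
@[reducible]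
noncomputable def siegelStarChartedSpace (hkn : 2 * k ≤ n) (h : IsWeaklyHyperbolic lam) :
    ChartedSpace (Cn (n - k)) (siegelStar lam) where
  atlas := Set.range (starChartAt hkn h)
  chartAt := starChartAt hkn h
  mem_chart_source w := (foliatedChartAt hkn h w).mem_target
  chart_mem_atlas w := ⟨w, rfl⟩

/-- A transition map is a complex affine map followed by `coord ∘ siegelRetr`, which is holomorphic.
-/
theorem isManifold_siegelStar (hkn : 2 * k ≤ n) (h : IsWeaklyHyperbolic lam) :
    letI := siegelStarChartedSpace hkn h
    IsManifold 𝓘(ℂ, Cn (n - k)) ω (siegelStar lam) := by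
  let _ := siegelStarChartedSpace hkn h
  refine isManifold_of_contDiffOn _ _ _ ?_
  rintro _ _ ⟨w, rfl⟩ ⟨w', rfl⟩
  rintro x ⟨⟨hx1, hx2⟩, -⟩
  set c := foliatedChartAt hkn h w
  set c' := foliatedChartAt hkn h w'
  have hx1' : x ∈ (starChartAt hkn h w).target := hx1
  have hx2' : (siegelProj lam w (w + c.dir x) : Cn n) ∈ c'.param.target := hx2
  rw [coe_siegelProj hkn h _ hx1'.1] at hx2'
  refine ContDiffAt.contDiffWithinAt ?_
  have h1 : ContDiffAt ℂ ω (fun x => (w : Cn n) + c.dir x) x :=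
    contDiffAt_const.add c.dir.contDiff.contDiffAt
  have h2 : ContDiffAt ℂ ω ((fun y => c'.coord (siegelRetr lam y)) ∘
      fun x => (w : Cn n) + c.dir x) x :=
    ContDiffAt.comp x (c'.contDiffAt_coord_siegelRetr hkn h hx1'.1 hx2') h1
  refine h2.congr_of_eventuallyEq ?_
  filter_upwards [(starChartAt hkn h w).open_target.mem_nhds hx1'] with y hy
  change c'.coord (siegelProj lam w (w + c.dir y)) = _
  rw [coe_siegelProj hkn h _ hy.1, Function.comp_apply]

theorem contDiffAt_coe_starChartAt_symm (hkn : 2 * k ≤ n) (h : IsWeaklyHyperbolic lam)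
    (w : siegelStar lam) :
    ContDiffAt ℝ ω (fun x => ((starChartAt hkn h w).symm x : Cn n)) (starChartAt hkn h w w) := by
  set c := foliatedChartAt hkn h w
  have hx : starChartAt hkn h w w ∈ (starChartAt hkn h w).target :=
    (starChartAt hkn h w).map_source c.mem_target
  have h1 : ContDiffAt ℝ ω (fun x => (w : Cn n) + c.dir x) (starChartAt hkn h w w) :=
    contDiffAt_const.add (c.dir.restrictScalars ℝ).contDiff.contDiffAt
  have h2 : ContDiffAt ℝ ω (siegelRetr lam ∘ fun x => (w : Cn n) + c.dir x)
      (starChartAt hkn h w w) :=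
    ContDiffAt.comp _ (contDiffAt_siegelRetr hkn h hx.1) h1
  refine h2.congr_of_eventuallyEq ?_
  filter_upwards [(starChartAt hkn h w).open_target.mem_nhds hx] with y hy
  exact coe_siegelProj hkn h _ hy.1

/-- The ambient function `coord` is a differentiable local left inverse of the parametrization. -/
theorem injective_fderiv_coe_starChartAt_symm (hkn : 2 * k ≤ n) (h : IsWeaklyHyperbolic lam)
    (w : siegelStar lam) :
    Function.Injective
      (fderiv ℝ (fun x => ((starChartAt hkn h w).symm x : Cn n)) (starChartAt hkn h w w)) := by
  set c := foliatedChartAt hkn h w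
  set x₀ := starChartAt hkn h w w
  have hx : x₀ ∈ (starChartAt hkn h w).target := (starChartAt hkn h w).map_source c.mem_target
  have hd : DifferentiableAt ℝ (fun x => ((starChartAt hkn h w).symm x : Cn n)) x₀ :=
    (contDiffAt_coe_starChartAt_symm hkn h w).differentiableAt (by simp)
  have hw : ((starChartAt hkn h w).symm x₀ : Cn n) = w :=
    congrArg Subtype.val ((starChartAt hkn h w).left_inv c.mem_target)
  have hc : DifferentiableAt ℝ c.coord ((starChartAt hkn h w).symm x₀ : Cn n) := by
    rw [hw]
    exact ((c.contDiffAt_coord c.mem_target).differentiableAt (by simp)).restrictScalars ℝ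
  have hid : c.coord ∘ (fun x => ((starChartAt hkn h w).symm x : Cn n)) =ᶠ[𝓝 x₀] id := by
    filter_upwards [(starChartAt hkn h w).open_target.mem_nhds hx] with y hy
    exact (starChartAt hkn h w).right_inv hy
  have hcomp := (hc.hasFDerivAt.comp x₀ hd.hasFDerivAt).fderiv
  rw [hid.fderiv_eq, fderiv_id] at hcomp
  refine Function.LeftInverse.injective
    (g := fderiv ℝ c.coord ((starChartAt hkn h w).symm x₀ : Cn n)) fun v => ?_
  exact (congrArg (fun A => A v) hcomp).symm

theorem contMDiffAt_coe_siegelStar (hkn : 2 * k ≤ n) (h : IsWeaklyHyperbolic lam)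
    (w : siegelStar lam) :
    letI := siegelStarChartedSpace hkn h
    ContMDiffAt 𝓘(ℝ, Cn (n - k)) 𝓘(ℝ, Cn n) ∞ (Subtype.val : siegelStar lam → Cn n) w := by
  let _ := siegelStarChartedSpace hkn h
  refine contMDiffAt_iff.2 ⟨continuous_subtype_val.continuousAt, ?_⟩
  exact ((contDiffAt_coe_starChartAt_symm hkn h w).of_le le_top).contDiffWithinAt

theorem injective_mfderiv_coe_siegelStar (hkn : 2 * k ≤ n) (h : IsWeaklyHyperbolic lam)
    (w : siegelStar lam) :
    letI := siegelStarChartedSpace hkn h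
    Function.Injective (mfderiv 𝓘(ℝ, Cn (n - k)) 𝓘(ℝ, Cn n)
      (Subtype.val : siegelStar lam → Cn n) w) := by
  let _ := siegelStarChartedSpace hkn h
  rw [((contMDiffAt_coe_siegelStar hkn h w).mdifferentiableAt (by simp)).mfderiv,
    modelWithCornersSelf_coe, Set.range_id, fderivWithin_univ]
  exact injective_fderiv_coe_starChartAt_symm hkn h w

theorem contMDiffAt_siegelProj (hkn : 2 * k ≤ n) (h : IsWeaklyHyperbolic lam)
    (w₀ : siegelStar lam) {z : Cn n} (hz : z ∈ siegelSet lam) :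
    letI := siegelStarChartedSpace hkn h
    ContMDiffAt 𝓘(ℂ, Cn n) 𝓘(ℂ, Cn (n - k)) ω (siegelProj lam w₀) z := by
  let _ := siegelStarChartedSpace hkn h
  refine contMDiffAt_iff.2 ⟨(continuousOn_siegelProj hkn h w₀).continuousAt
    (siegelSet_mem_nhds hkn h hz), ?_⟩
  set c := foliatedChartAt hkn h (siegelProj lam w₀ z)
  have hzc : siegelRetr lam z ∈ c.param.target := by
    rw [← coe_siegelProj hkn h w₀ hz]
    exact c.mem_target
  refine ContDiffAt.contDiffWithinAt ?_
  refine (c.contDiffAt_coord_siegelRetr hkn h hz hzc).congr_of_eventuallyEq ?_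
  filter_upwards [siegelSet_mem_nhds hkn h hz] with y hy
  change c.coord (siegelProj lam w₀ y) = _
  rw [coe_siegelProj hkn h _ hy]

theorem surjective_mfderiv_siegelProj (hkn : 2 * k ≤ n) (h : IsWeaklyHyperbolic lam)
    (w₀ : siegelStar lam) {z : Cn n} (hz : z ∈ siegelSet lam) :
    letI := siegelStarChartedSpace hkn h
    Function.Surjective (mfderiv 𝓘(ℂ, Cn n) 𝓘(ℂ, Cn (n - k)) (siegelProj lam w₀) z) := by
  let _ := siegelStarChartedSpace hkn h
  rw [((contMDiffAt_siegelProj hkn h w₀ hz).mdifferentiableAt (by simp)).mfderiv,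
    modelWithCornersSelf_coe, Set.range_id, fderivWithin_univ]
  set c := foliatedChartAt hkn h (siegelProj lam w₀ z)
  have hzc : siegelRetr lam z ∈ c.param.target := by
    rw [← coe_siegelProj hkn h w₀ hz]
    exact c.mem_target
  have heq : writtenInExtChartAt 𝓘(ℂ, Cn n) 𝓘(ℂ, Cn (n - k)) z (siegelProj lam w₀) =ᶠ[𝓝 z]
      fun y => c.coord (siegelRetr lam y) := by
    filter_upwards [siegelSet_mem_nhds hkn h hz] with y hy
    change c.coord (siegelProj lam w₀ y) = _
    rw [coe_siegelProj hkn h _ hy]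
  have h1 := c.surjective_fderiv_coord_siegelRetr hkn h hz hzc
  rw [← heq.fderiv_eq] at h1
  exact h1

end

theorem mainTheorem8 {n k : ℕ} (hk : 0 < k) (hkn : 2 * k < n)
    (lam : Matrix (Fin n) (Fin k) ℂ) (hrank : lam.rank = k) (hadm : IsAdmissible lam) :
    -- `Ψ` is a mixed map and a mixed ICIS
    (IsMixedMap (siegelMap lam) ∧ IsMixedICIS (siegelMap lam)) ∧
    -- the Siegel leaves fill an open set, and every leaf through `𝒯*` is a Siegel leaf
    IsOpen (siegelSet lam) ∧
    ∃ hsub : siegelStar lam ⊆ siegelSet lam,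
      -- `z ↦ leaf through z` is a homeomorphism from `𝒯*` to the space of Siegel leaves
      IsHomeomorph (fun z : siegelStar lam =>
        (Quotient.mk _ ⟨z, hsub z.2⟩ : SiegelLeafSpace lam)) ∧
      -- `𝒯*` has the structure of a complex manifold of dimension `n - k`
      ∃ _ : ChartedSpace (Cn (n - k)) (siegelStar lam),
        IsManifold 𝓘(ℂ, Cn (n - k)) ω (siegelStar lam) ∧
        -- it is a smooth real submanifold of `ℂⁿ`
        ContMDiff 𝓘(ℝ, Cn (n - k)) 𝓘(ℝ, Cn n) ∞ (Subtype.val : siegelStar lam → Cn n) ∧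
        (∀ z : siegelStar lam, Function.Injective
          (mfderiv 𝓘(ℝ, Cn (n - k)) 𝓘(ℝ, Cn n) (Subtype.val : siegelStar lam → Cn n) z)) ∧
        -- sending a point to the point of `𝒯*` on its leaf is a holomorphic submersion
        ∃ π : Cn n → siegelStar lam,
          (∀ z ∈ siegelSet lam, (π z : Cn n) ∈ leaf lam z) ∧
          ContMDiffOn 𝓘(ℂ, Cn n) 𝓘(ℂ, Cn (n - k)) ω π (siegelSet lam) ∧
          ∀ z ∈ siegelSet lam, Function.Surjective
            (mfderiv 𝓘(ℂ, Cn n) 𝓘(ℂ, Cn (n - k)) π z) := by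
  have h := hadm.weaklyHyperbolic
  -- This point is the value of the projection off `𝒮`.
  obtain ⟨w, hw⟩ := exists_mem_siegelStar hadm.siegel
  let _ := siegelStarChartedSpace hkn.le h
  refine ⟨⟨isMixedMap_siegelMap, isMixedICIS_siegelMap hk hkn hadm⟩, isOpen_siegelSet hkn.le h,
    siegelStar_subset_siegelSet, isHomeomorph_siegelLeafSpace hkn.le h ⟨w, hw⟩ _,
    siegelStarChartedSpace hkn.le h, isManifold_siegelStar hkn.le h,
    fun z => contMDiffAt_coe_siegelStar hkn.le h z,
    fun z => injective_mfderiv_coe_siegelStar hkn.le h z, siegelProj lam ⟨w, hw⟩, ?_, ?_, ?_⟩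
  · intro z hz
    rw [coe_siegelProj hkn.le h _ hz]
    exact ⟨_, rfl⟩
  · exact fun z hz => (contMDiffAt_siegelProj hkn.le h _ hz).contMDiffWithinAt
  · exact fun z hz => surjective_mfderiv_siegelProj hkn.le h _ hz
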